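/- A permutation is a finite word of positive integers without repeated letters, and $S_n$ is the set of permutations whose letters are exactly $1,\dots,n$. The stack-sorting map $s$ is defined recursively: $s$ sends the empty permutation to itself, and if $\pi=LmR$ where $m$ is the largest entry of $\pi$, then $s(\pi)=s(L)\,s(R)\,m$. A permutation $\pi$ is uniquely sorted if $|s^{-1}(\pi)|=1$. A permutation $\sigma=\sigma_1\cdots\sigma_n$ avoids $312$ if there are no indices $i_1<i_2<i_3$ with $\sigma_{i_2}<\sigma_{i_3}<\sigma_{i_1}$. Let $\mathcal U_n(312)$ be the set of uniquely sorted permutations in $S_n$ that avoid $312$, and let $C_m=\frac{1}{m+1}\binom{2m}{m}$ be the $m$-th Catalan number. Then for every nonnegative integer $k$, \[|\mathcal U_{2k+1}(312)|=C_kC_{k+2}-C_{k+1}^2=\frac{6}{(k+1)(k+2)^2(k+3)}\binom{2k}{k}\binom{2k+2}{k+1}.\] -/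

import Mathlib

/-- A permutation, in one-line notation: a finite word of positive integers without repeated
letters. -/
def IsPermutation (π : List ℕ) : Prop :=
  π.Nodup ∧ ∀ a ∈ π, 0 < a

/-- `S_n`: the words in which each of `1, …, n` occurs exactly once and nothing else occurs. -/
def symmetricWords (n : ℕ) : Set (List ℕ) :=
  {π | IsPermutation π ∧ ∀ a, a ∈ π ↔ 1 ≤ a ∧ a ≤ n}

/-- The largest entry of a word (`0` for the empty word). -/
def largestEntry (π : List ℕ) : ℕ :=
  π.foldr max 0

theorem largestEntry_mem (a : ℕ) (l : List ℕ) : largestEntry (a :: l) ∈ a :: l := by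
  induction l generalizing a with
  | nil => simp [largestEntry]
  | cons b l ih =>
    have h := ih b
    have e : largestEntry (a :: b :: l) = max a (largestEntry (b :: l)) := rfl
    rcases le_total a (largestEntry (b :: l)) with hab | hab
    · rw [e, max_eq_right hab]
      exact List.mem_cons_of_mem _ h
    · rw [e, max_eq_left hab]
      exact List.mem_cons_self

/-- The part `L` of the word `π = L m R` that precedes the (first) occurrence of `m`. -/
def wordBefore (m : ℕ) (π : List ℕ) : List ℕ :=
  π.takeWhile (fun x => x ≠ m)

/-- The part `R` of the word `π = L m R` that follows the (first) occurrence of `m`. -/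
def wordAfter (m : ℕ) (π : List ℕ) : List ℕ :=
  (π.dropWhile (fun x => x ≠ m)).tail

theorem wordBefore_append_wordAfter (m : ℕ) (π : List ℕ) (h : m ∈ π) :
    wordBefore m π ++ m :: wordAfter m π = π := by
  induction π with
  | nil => simp at h
  | cons b l ih =>
    by_cases hb : b = m
    · subst hb
      simp [wordBefore, wordAfter]
    · have hl : m ∈ l := by
        rcases List.mem_cons.mp h with h | h
        · exact absurd h.symm hb
        · exact h
      have := ih hl
      simp only [wordBefore, wordAfter] at this ⊢
      simpa [List.takeWhile_cons, List.dropWhile_cons, hb] using this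

theorem length_wordBefore_add_length_wordAfter (a : ℕ) (l : List ℕ) :
    (wordBefore (largestEntry (a :: l)) (a :: l)).length
      + (wordAfter (largestEntry (a :: l)) (a :: l)).length = l.length := by
  have h := congrArg List.length
    (wordBefore_append_wordAfter _ (a :: l) (largestEntry_mem a l))
  simp only [List.length_append, List.length_cons] at h
  omega

/-- West's stack-sorting map: the empty word is sent to itself, and `s (L m R) = s(L) s(R) m`,
where `m` is the largest entry. -/
def stackSort : List ℕ → List ℕ
  | [] => []
  | a :: l =>
    stackSort (wordBefore (largestEntry (a :: l)) (a :: l))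
      ++ stackSort (wordAfter (largestEntry (a :: l)) (a :: l))
      ++ [largestEntry (a :: l)]
termination_by π => π.length
decreasing_by
  · have := length_wordBefore_add_length_wordAfter a l
    simp only [List.length_cons]
    omega
  · have := length_wordBefore_add_length_wordAfter a l
    simp only [List.length_cons]
    omega

/-- The fertility of `π`: the number of permutations that the stack-sorting map sends to `π`. -/
noncomputable def fertility (π : List ℕ) : ℕ :=
  {σ : List ℕ | IsPermutation σ ∧ stackSort σ = π}.ncard

/-- `π` is uniquely sorted if its fertility is `1`. -/
def IsUniquelySorted (π : List ℕ) : Prop :=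
  fertility π = 1

/-- The normalization of a permutation: the `i`-th smallest entry is replaced by `i`. -/
def normalization (π : List ℕ) : List ℕ :=
  π.map (fun a => π.countP (fun b => b ≤ a))

/-- `σ` contains the pattern `τ` if some subword of `σ` (entries at increasing positions, not
necessarily adjacent) has the same relative order as `τ`. -/
def ContainsPattern (σ τ : List ℕ) : Prop :=
  ∃ ρ : List ℕ, ρ.Sublist σ ∧ normalization ρ = normalization τ

/-- `σ` avoids the pattern `τ`. -/
def AvoidsPattern (σ τ : List ℕ) : Prop :=
  ¬ ContainsPattern σ τ

/-- `U_n(τ)`: the uniquely sorted permutations in `S_n` that avoid the pattern `τ`. -/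
def uniquelySortedAvoiding (n : ℕ) (τ : List ℕ) : Set (List ℕ) :=
  {π | π ∈ symmetricWords n ∧ IsUniquelySorted π ∧ AvoidsPattern π τ}

/-! Attach to a word the path that starts at height 1, rises at descents and falls at ascents, the
first letter counting as an ascent. A nonempty stack-sorted word factors as `A B m` with `A`, `B`
stack-sorted and `m` maximal, and induction shows that its path ends at height at most 0. Equality
forces either `A = B = []` or a descent from `A` to `B` with equality in both; then the path stays
nonnegative and the preimage is unique (`stackSort_injective_of_descentHeight`). Conversely, unique
sortedness forces equality (`IsUniquelySorted.descentHeight_eq`). When 312 is avoided, a ballot path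
already makes the word stack-sorted, so the words to count are the 312-avoiding ballot words
(`isUniquelySorted_iff_isBallot`).

In such a word each letter is either the largest smaller letter skipped so far (a descent) or a new
maximum (an ascent). Hence only the numbers of skipped and unread letters and the height matter,
which gives the recursion `completions`. Height plus number of skipped letters traces a second path
above the first. Counting noncrossing pairs suggests a 2×2 determinant of ballot numbers; that it
solves the recursion is checked by Pascal's rule alone (`completions_eq_fallingPathPairs`), and its
value is computed in `pathPairs_self`. -/

/-! ### Binomial coefficients with integer index and ballot numbers. -/

/-- The binomial coefficient `n` choose `j`, extended by `0` to negative `j`. -/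
def intChoose (n : ℕ) (j : ℤ) : ℤ :=
  if 0 ≤ j then (n.choose j.toNat : ℤ) else 0

theorem intChoose_natCast (n j : ℕ) : intChoose n (j : ℤ) = n.choose j := by
  simp [intChoose]

theorem intChoose_of_neg (n : ℕ) {j : ℤ} (h : j < 0) : intChoose n j = 0 := by
  simp [intChoose, not_le.mpr h]

theorem intChoose_succ (n : ℕ) (j : ℤ) :
    intChoose (n + 1) j = intChoose n j + intChoose n (j - 1) := by
  rcases lt_trichotomy j 0 with h | rfl | h
  · simp [intChoose_of_neg _ h, intChoose_of_neg _ (show j - 1 < 0 by omega)]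
  · simp [intChoose]
  · obtain ⟨i, rfl⟩ : ∃ i : ℕ, j = (i + 1 : ℕ) := ⟨(j - 1).toNat, by omega⟩
    rw [show ((i + 1 : ℕ) : ℤ) - 1 = (i : ℤ) by push_cast; ring]
    simp only [intChoose_natCast, Nat.choose_succ_succ]
    push_cast
    ring

theorem intChoose_symm {n : ℕ} {i j : ℤ} (h : i + j = n) : intChoose n i = intChoose n j := by
  rcases lt_or_ge i 0 with hi | hi
  · obtain ⟨j', rfl⟩ : ∃ j' : ℕ, j = (j' : ℤ) := ⟨j.toNat, by omega⟩
    rw [intChoose_of_neg _ hi, intChoose_natCast, Nat.choose_eq_zero_of_lt (by omega)]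
    simp
  · rcases lt_or_ge j 0 with hj | hj
    · obtain ⟨i', rfl⟩ : ∃ i' : ℕ, i = (i' : ℤ) := ⟨i.toNat, by omega⟩
      rw [intChoose_of_neg _ hj, intChoose_natCast, Nat.choose_eq_zero_of_lt (by omega)]
      simp
    · obtain ⟨i', rfl⟩ : ∃ i' : ℕ, i = (i' : ℤ) := ⟨i.toNat, by omega⟩
      obtain ⟨j', rfl⟩ : ∃ j' : ℕ, j = (j' : ℤ) := ⟨j.toNat, by omega⟩
      rw [intChoose_natCast, intChoose_natCast, Nat.choose_symm_of_eq_add (show n = i' + j' by omega)]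

theorem intChoose_sub_one_mul (n : ℕ) (j : ℤ) :
    intChoose n (j - 1) * (n - j + 1) = j * intChoose n j := by
  rcases lt_trichotomy j 0 with h | rfl | h
  · simp [intChoose_of_neg _ h, intChoose_of_neg _ (show j - 1 < 0 by omega)]
  · simp [intChoose]
  · obtain ⟨i, rfl⟩ : ∃ i : ℕ, j = (i + 1 : ℕ) := ⟨(j - 1).toNat, by omega⟩
    rw [show ((i + 1 : ℕ) : ℤ) - 1 = (i : ℤ) by push_cast; ring]
    simp only [intChoose_natCast]
    rcases le_or_gt i n with hin | hin
    · have := Nat.choose_succ_right_eq n i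
      zify [hin] at this
      push_cast
      linarith
    · rw [Nat.choose_eq_zero_of_lt hin, Nat.choose_eq_zero_of_lt (by omega)]
      simp

/-- Nonnegative lattice paths with `n` steps, `j` of them down, starting at height `0`. -/
def ballotZero (n : ℕ) (j : ℤ) : ℤ := intChoose n j - intChoose n (j - 1)

/-- Nonnegative lattice paths with `n` steps, `j` of them down, starting at height `2`. -/
def ballotTwo (n : ℕ) (j : ℤ) : ℤ := intChoose n j - intChoose n (j - 3)

theorem ballotZero_succ (n : ℕ) (j : ℤ) :
    ballotZero (n + 1) j = ballotZero n j + ballotZero n (j - 1) := by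
  simp only [ballotZero, intChoose_succ]
  ring

theorem ballotTwo_succ (n : ℕ) (j : ℤ) :
    ballotTwo (n + 1) j = ballotTwo n j + ballotTwo n (j - 1) := by
  simp only [ballotTwo, intChoose_succ, show j - 3 - 1 = j - 1 - 3 by ring]
  ring

/-! ### Recurrences for the path-pair determinant. -/

/-- The Lindström–Gessel–Viennot determinant counting pairs of noncrossing ballot paths, the lower
one with `d`, the upper one with `e` rises left, and both with `a` falls left. -/
def pathPairs (a d e : ℕ) : ℤ :=
  ballotZero (a + d) d * ballotTwo (a + e) e
    - ballotTwo (a + d) (d + 1) * ballotZero (a + e) (e - 1)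

/-- Pairs of noncrossing paths as in `pathPairs` in which the upper path continues with a fall. -/
def fallingPathPairs (a d : ℕ) : ℕ → ℤ
  | 0 => pathPairs a d 0
  | e + 1 => pathPairs a d (e + 1) - pathPairs a d e

/-- Pairs are classified by how far the upper path rises before its first fall; the differences
telescope. -/
theorem sum_fallingPathPairs (a d e : ℕ) :
    ∑ i ∈ Finset.range (e + 1), fallingPathPairs a d i = pathPairs a d e := by
  induction e with
  | zero => simp [fallingPathPairs]
  | succ e ih => rw [Finset.sum_range_succ, ih, fallingPathPairs]; ring

/-- Pascal's rule in the factors of the upper path removes its initial fall. -/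
theorem fallingPathPairs_succ (a d e : ℕ) :
    fallingPathPairs (a + 1) d e = ballotZero (a + 1 + d) d * ballotTwo (a + e) e
      - ballotTwo (a + 1 + d) (d + 1) * ballotZero (a + e) (e - 1) := by
  cases e with
  | zero =>
    simp only [fallingPathPairs, pathPairs, add_zero, ballotTwo_succ a, ballotZero_succ a]
    simp [ballotTwo, ballotZero, intChoose]
  | succ e =>
    simp only [fallingPathPairs, pathPairs]
    rw [show a + 1 + (e + 1) = a + (e + 1) + 1 by ring, ballotTwo_succ (a + (e + 1)),
      ballotZero_succ (a + (e + 1)), show a + 1 + e = a + (e + 1) by ring]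
    push_cast
    rw [show (e : ℤ) + 1 - 1 = e by ring]
    ring

/-- The two terms are the two possible first steps of the lower path, a rise or a fall. -/
theorem fallingPathPairs_succ_succ (a d e : ℕ) :
    fallingPathPairs (a + 1) (d + 1) e
      = fallingPathPairs (a + 1) d e + pathPairs a (d + 1) e := by
  rw [fallingPathPairs_succ, fallingPathPairs_succ, pathPairs,
    show a + 1 + (d + 1) = a + (d + 1) + 1 by ring, ballotZero_succ (a + (d + 1)),
    ballotTwo_succ (a + (d + 1)), show a + 1 + d = a + (d + 1) by ring]
  push_cast
  rw [show (d : ℤ) + 1 + 1 - 1 = d + 1 by ring, show (d : ℤ) + 1 - 1 = d by ring]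
  ring

/-- When the paths touch, the lower one cannot rise: the corresponding Pascal terms form a
determinant with two equal rows. -/
theorem fallingPathPairs_succ_self (a d : ℕ) :
    fallingPathPairs (a + 1) d d = pathPairs a d d := by
  rw [fallingPathPairs_succ, pathPairs, show a + 1 + d = a + d + 1 by ring, ballotZero_succ,
    ballotTwo_succ, show (d : ℤ) + 1 - 1 = d by ring]
  ring

/-- The lower path would be at height -1, on the reflection line, so both of its entries vanish. -/
theorem pathPairs_succ_eq_zero (a e : ℕ) : pathPairs a (a + 1) e = 0 := by
  have h0 : ballotZero (a + (a + 1)) ((a + 1 : ℕ) : ℤ) = 0 := by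
    rw [ballotZero, sub_eq_zero]
    exact intChoose_symm (by push_cast; ring)
  have h2 : ballotTwo (a + (a + 1)) (((a + 1 : ℕ) : ℤ) + 1) = 0 := by
    rw [ballotTwo, sub_eq_zero]
    exact intChoose_symm (by push_cast; ring)
  rw [pathPairs, h0, h2]
  ring

theorem fallingPathPairs_zero : fallingPathPairs 0 0 0 = 1 := by
  simp [fallingPathPairs, pathPairs, ballotZero, ballotTwo, intChoose]

/-! ### The letter-by-letter recursion and its solution. -/

/-- The number of ways to complete a `312`-avoiding word by `r` letters when `s` smaller letters
have been skipped, `u` larger letters are left and the descent path is at height `h`. -/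
def completions : ℕ → ℕ → ℕ → ℕ → ℕ
  | 0, _, _, h => if h = 0 then 1 else 0
  | r + 1, s, u, h =>
    (if s = 0 then 0 else completions r (s - 1) u (h + 1))
      + if h = 0 then 0 else ∑ i ∈ Finset.range u, completions r (s + i) (u - 1 - i) (h - 1)

/-- Skipped letters all return as descents, so at least `s` rises and at most `u` falls remain;
height 0 is out of reach. -/
theorem completions_eq_zero (r s u h : ℕ) (hr : s + u = r) (hu : u < s + h) :
    completions r s u h = 0 := by
  induction r generalizing s u h with
  | zero => simp [completions]; omega
  | succ r ih =>
    rw [completions, Nat.add_eq_zero_iff]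
    constructor
    · split_ifs with hs
      · rfl
      · exact ih _ _ _ (by omega) (by omega)
    · split_ifs with hs
      · rfl
      · refine Finset.sum_eq_zero fun i hi => ?_
        rw [Finset.mem_range] at hi
        exact ih _ _ _ (by omega) (by omega)

/-- Here `e` is the number of unread letters still to be skipped, so `s + e` descents and `h + s +
e` ascents remain. -/
theorem completions_eq_fallingPathPairs (r s h e : ℕ) (hr : 2 * s + h + 2 * e = r) :
    (completions r s (s + h + 2 * e) h : ℤ) = fallingPathPairs (h + s + e) (s + e) e := by
  induction r generalizing s h e with
  | zero =>
    obtain ⟨rfl, rfl, rfl⟩ : s = 0 ∧ h = 0 ∧ e = 0 := by omega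
    simp [completions, fallingPathPairs_zero]
  | succ r ih =>
    have hsum : ∀ g, h = g + 1 → (∑ i ∈ Finset.range (s + h + 2 * e),
        completions r (s + i) (s + h + 2 * e - 1 - i) (h - 1) : ℤ)
          = pathPairs (g + s + e) (s + e) e := by
      rintro g rfl
      rw [← sum_fallingPathPairs, ← Finset.sum_range_reflect _ (e + 1)]
      -- At most `e` letters can be skipped: the terms with `i > e` vanish by `completions_eq_zero`.
      rw [← Finset.sum_subset (Finset.range_subset_range.mpr (show e + 1 ≤ s + (g + 1) + 2 * e by omega))]
      · refine Finset.sum_congr rfl fun i hi => ?_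
        rw [Finset.mem_range] at hi
        have := ih (s + i) g (e - i) (by omega)
        rw [show g + 1 - 1 = g by omega,
          show s + (g + 1) + 2 * e - 1 - i = s + i + g + 2 * (e - i) by omega, this]
        congr 1 <;> omega
      · intro i hi hi'
        rw [Finset.mem_range] at hi hi'
        rw [completions_eq_zero _ _ _ _ (by omega) (by omega)]
        simp
    rw [completions]
    push_cast
    rcases s with _ | s
    · rcases h with _ | g
      · rcases e with _ | e
        · omega
        · simp only [if_true]
          rw [show 0 + 0 + (e + 1) = e + 1 by ring,
            fallingPathPairs_succ_self, pathPairs_succ_eq_zero]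
          simp
      · have := hsum g rfl
        rw [if_pos rfl, if_neg (by omega), this, show g + 1 + 0 + e = g + 0 + e + 1 by ring,
          show 0 + e = e by ring, fallingPathPairs_succ_self]
        simp
    · have h1 := ih s (h + 1) e (by omega)
      rw [if_neg (by omega), show s + 1 - 1 = s by omega,
        show s + 1 + h + 2 * e = s + (h + 1) + 2 * e by ring, h1,
        show h + (s + 1) + e = h + s + e + 1 by ring, show s + 1 + e = s + e + 1 by ring,
        fallingPathPairs_succ_succ, show h + 1 + s + e = h + s + e + 1 by ring]
      congr 1
      rcases h with _ | g
      · rw [if_pos rfl, show 0 + s + e = s + e by ring, pathPairs_succ_eq_zero]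
      · have := hsum g rfl
        rw [if_neg (by omega)]
        rw [show s + 1 + (g + 1) + 2 * e = s + (g + 1 + 1) + 2 * e by ring,
          show g + (s + 1) + e = g + 1 + s + e by ring, show s + 1 + e = s + e + 1 by ring] at this
        exact this

theorem completions_two_mul_add_one (k : ℕ) :
    (completions (2 * k + 1) 0 (2 * k + 1) 1 : ℤ) = pathPairs k k k := by
  have := completions_eq_fallingPathPairs (2 * k + 1) 0 1 k (by ring)
  rw [show 0 + 1 + 2 * k = 2 * k + 1 by ring, show 1 + 0 + k = k + 1 by ring,
    show 0 + k = k by ring, fallingPathPairs_succ_self] at this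
  exact this

/-! ### Evaluation by Catalan numbers. -/

theorem catalan_cast_mul (k : ℕ) : (catalan k : ℚ) * (k + 1) = (2 * k).choose k := by
  have := succ_mul_catalan_eq_centralBinom k
  rw [Nat.centralBinom] at this
  rw [← this]
  push_cast
  ring

theorem catalan_succ_cast_mul (k : ℕ) :
    (catalan (k + 1) : ℚ) * (k + 2) = 2 * (2 * k + 1) * catalan k := by
  have h := Nat.succ_mul_centralBinom_succ k
  rw [← succ_mul_catalan_eq_centralBinom, ← succ_mul_catalan_eq_centralBinom] at h
  have h' : ((k : ℚ) + 1) * ((k + 1 + 1) * catalan (k + 1))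
      = 2 * (2 * k + 1) * ((k + 1) * catalan k) := by exact_mod_cast h
  have hk : (k : ℚ) + 1 ≠ 0 := by positivity
  apply mul_left_cancel₀ hk
  linarith

theorem catalan_succ_cast (k : ℕ) :
    (catalan (k + 1) : ℚ) = 2 * (2 * k + 1) / (k + 2) * catalan k := by
  have := catalan_succ_cast_mul k
  field_simp
  linarith

/-- Every binomial coefficient involved is a rational multiple of `catalan k`, which leaves an
identity of rational functions. -/
theorem pathPairs_self (k : ℕ) :
    (pathPairs k k k : ℚ)
      = (catalan k : ℚ) * (catalan (k + 2) : ℚ) - (catalan (k + 1) : ℚ) ^ 2 := by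
  have hx : (intChoose (k + k) k : ℚ) = catalan k * (k + 1) := by
    rw [catalan_cast_mul, intChoose_natCast, two_mul]
    simp
  have h1 : (intChoose (k + k) (k - 1) : ℚ) * (k + 1) = k * intChoose (k + k) k := by
    have := intChoose_sub_one_mul (k + k) k
    rw [show ((k + k : ℕ) : ℤ) - k + 1 = k + 1 by push_cast; ring] at this
    exact_mod_cast this
  have h2 : (intChoose (k + k) (k - 2) : ℚ) * (k + 2) = (k - 1) * intChoose (k + k) (k - 1) := by
    have := intChoose_sub_one_mul (k + k) (k - 1)
    rw [show ((k + k : ℕ) : ℤ) - (k - 1) + 1 = k + 2 by push_cast; ring,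
      show (k : ℤ) - 1 - 1 = k - 2 by ring] at this
    exact_mod_cast this
  have h3 : (intChoose (k + k) (k - 3) : ℚ) * (k + 3) = (k - 2) * intChoose (k + k) (k - 2) := by
    have := intChoose_sub_one_mul (k + k) (k - 2)
    rw [show ((k + k : ℕ) : ℤ) - (k - 2) + 1 = k + 3 by push_cast; ring,
      show (k : ℤ) - 2 - 1 = k - 3 by ring] at this
    exact_mod_cast this
  have hs : intChoose (k + k) (k + 1) = intChoose (k + k) (k - 1) :=
    intChoose_symm (by push_cast; ring)
  rw [hx] at h1
  have e1 : (intChoose (k + k) (k - 1) : ℚ) = k * catalan k := by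
    have hk : (k : ℚ) + 1 ≠ 0 := by positivity
    apply mul_right_cancel₀ hk
    linarith
  have e2 : (intChoose (k + k) (k - 2) : ℚ) = (k - 1) * k / (k + 2) * catalan k := by
    rw [e1] at h2
    field_simp
    linarith
  have e3 : (intChoose (k + k) (k - 3) : ℚ)
      = (k - 2) * (k - 1) * k / ((k + 2) * (k + 3)) * catalan k := by
    rw [e2] at h3
    field_simp at h3 ⊢
    linarith
  have c2 := catalan_succ_cast (k + 1)
  rw [catalan_succ_cast k] at c2
  rw [catalan_succ_cast k, c2]
  simp only [pathPairs, ballotZero, ballotTwo, hs, show (k : ℤ) - 1 - 1 = k - 2 by ring,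
    show (k : ℤ) + 1 - 3 = k - 2 by ring]
  push_cast
  rw [hx, e1, e2, e3]
  field_simp
  ring

theorem catalan_mul_sub_sq (k : ℕ) :
    (catalan k : ℚ) * (catalan (k + 2) : ℚ) - (catalan (k + 1) : ℚ) ^ 2
      = 6 / (((k : ℚ) + 1) * ((k : ℚ) + 2) ^ 2 * ((k : ℚ) + 3))
        * ((2 * k).choose k : ℚ) * ((2 * k + 2).choose (k + 1) : ℚ) := by
  have c1 := catalan_cast_mul (k + 1)
  rw [show 2 * (k + 1) = 2 * k + 2 by ring] at c1
  have c2 := catalan_succ_cast (k + 1)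
  rw [← catalan_cast_mul, ← c1, c2, catalan_succ_cast]
  push_cast
  field_simp
  ring

/-! ### Ballot words and avoidance of 312. -/

/-- `IsBallot h p w`: the path that starts at height `h` and, when the word `w` is read after the
letter `p`, rises at each descent and falls at each ascent, stays nonnegative and ends at `0`. -/
def IsBallot : ℕ → ℕ → List ℕ → Prop
  | h, _, [] => h = 0
  | h, p, x :: w => (x < p ∧ IsBallot (h + 1) x w) ∨ (p ≤ x ∧ 0 < h ∧ IsBallot (h - 1) x w)

/-- A recursive form of avoiding the pattern `312`. -/
def Avoids312 : List ℕ → Prop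
  | [] => True
  | x :: w => w.Pairwise (fun a b => b < x → b ≤ a) ∧ Avoids312 w

theorem normalization_eq_iff (ρ : List ℕ) :
    normalization ρ = normalization [3, 1, 2] ↔ ∃ c a b, ρ = [c, a, b] ∧ a < b ∧ b < c := by
  have h312 : normalization [3, 1, 2] = [3, 1, 2] := by decide
  rw [h312]
  constructor
  · intro h
    have hl : ρ.length = 3 := by simpa [normalization] using congrArg List.length h
    obtain ⟨c, a, b, rfl⟩ := List.length_eq_three.mp hl
    refine ⟨c, a, b, rfl, ?_⟩
    simp only [normalization, List.map_cons, List.map_nil, List.countP_cons, List.countP_nil,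
      List.cons.injEq, decide_eq_true_eq] at h
    grind
  · rintro ⟨c, a, b, rfl, hab, hbc⟩
    simp only [normalization, List.map_cons, List.map_nil, List.countP_cons, List.countP_nil,
      List.cons.injEq, decide_eq_true_eq]
    grind

theorem containsPattern_312_iff (σ : List ℕ) :
    ContainsPattern σ [3, 1, 2] ↔ ∃ c a b, [c, a, b].Sublist σ ∧ a < b ∧ b < c := by
  simp only [ContainsPattern, normalization_eq_iff]
  constructor
  · rintro ⟨_, hs, c, a, b, rfl, h⟩
    exact ⟨c, a, b, hs, h⟩
  · rintro ⟨c, a, b, hs, h⟩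
    exact ⟨_, hs, c, a, b, rfl, h⟩

theorem avoidsPattern_312_iff (σ : List ℕ) : AvoidsPattern σ [3, 1, 2] ↔ Avoids312 σ := by
  rw [AvoidsPattern, containsPattern_312_iff]
  induction σ with
  | nil => simp [Avoids312]
  | cons x w ih =>
    rw [Avoids312, ← ih, List.pairwise_iff_forall_sublist]
    constructor
    · intro h
      refine ⟨fun {a b} hs hb => ?_, fun ⟨c, a, b, hs, h'⟩ => h ⟨c, a, b, hs.cons _, h'⟩⟩
      by_contra hab
      exact h ⟨x, a, b, hs.cons_cons x, by omega, hb⟩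
    · rintro ⟨h1, h2⟩ ⟨c, a, b, hs, hab, hbc⟩
      rcases List.sublist_cons_iff.mp hs with hs | ⟨r, hr, hs⟩
      · exact h2 ⟨c, a, b, hs, hab, hbc⟩
      · obtain ⟨rfl, rfl⟩ := List.cons.inj hr
        exact absurd (h1 hs hbc) (by omega)

/-! ### Counting 312-avoiding ballot words. -/

/-- Words that can be counted by their first letter. -/
theorem exists_card_eq_sum_of_cons (P : List ℕ → Prop) (I : Finset ℕ) (Q : ℕ → List ℕ → Prop)
    (c : ℕ → ℕ) (hnil : ¬ P []) (hcons : ∀ x w, P (x :: w) ↔ x ∈ I ∧ Q x w)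
    (hc : ∀ x ∈ I, ∃ F : Finset (List ℕ), (∀ w, w ∈ F ↔ Q x w) ∧ F.card = c x) :
    ∃ F : Finset (List ℕ), (∀ w, w ∈ F ↔ P w) ∧ F.card = ∑ x ∈ I, c x := by
  classical
  choose! F hF hcard using hc
  refine ⟨I.biUnion fun x => (F x).image (List.cons x), fun w => ?_, ?_⟩
  · cases w with
    | nil => simp [hnil]
    | cons x w =>
      rw [hcons]
      simp only [Finset.mem_biUnion, Finset.mem_image, List.cons.injEq]
      constructor
      · rintro ⟨y, hy, v, hv, rfl, rfl⟩
        exact ⟨hy, (hF _ hy _).mp hv⟩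
      · rintro ⟨hx, hw⟩
        exact ⟨x, hx, w, (hF _ hx _).mpr hw, rfl, rfl⟩
  · rw [Finset.card_biUnion]
    · refine Finset.sum_congr rfl fun x hx => ?_
      rw [Finset.card_image_of_injective _ (List.cons_injective), hcard x hx]
    · intro x _ y _ hxy
      simp only [Function.onFun, Finset.disjoint_left, Finset.mem_image]
      rintro _ ⟨v, _, rfl⟩ ⟨v', _, h⟩
      exact hxy (List.cons.inj h).1.symm

/-- `w` completes a `312`-avoiding word with last letter `p` and largest letter `M`, whose skipped
letters form `S`, whose larger letters are `M + 1, …, n` and whose descent path is at `h`. -/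
def IsCompletion (S : Finset ℕ) (M n h p : ℕ) (w : List ℕ) : Prop :=
  w.Nodup ∧ (∀ y, y ∈ w ↔ y ∈ S ∨ (M < y ∧ y ≤ n)) ∧ w.Pairwise (fun a b => b ≤ M → b ≤ a) ∧
    Avoids312 w ∧ IsBallot h p w

/-- Since `x ≤ M`, the condition that `x` imposes as the letter 3 of a pattern already follows from
the one imposed by `M`. -/
theorem isCompletion_cons_skipped {S : Finset ℕ} {M n h p x : ℕ} {w : List ℕ}
    (hS : ∀ y ∈ S, y < p) (hp : p ≤ M) (hx : x ∈ S) (hmax : ∀ y ∈ S, y ≤ x) :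
    IsCompletion S M n h p (x :: w) ↔ IsCompletion (S.erase x) M n (h + 1) x w := by
  have hxp := hS x hx
  simp only [IsCompletion, Avoids312, IsBallot, List.nodup_cons, List.pairwise_cons,
    List.mem_cons, Finset.mem_erase]
  constructor
  · rintro ⟨⟨hxw, hw⟩, hmem, ⟨-, hpw⟩, ⟨-, hav⟩, hb⟩
    refine ⟨hw, fun y => ?_, hpw, hav, ?_⟩
    · have := hmem y
      constructor
      · intro hy
        have hne : y ≠ x := by rintro rfl; exact hxw hy
        rcases this.mp (Or.inr hy) with h | h
        · exact Or.inl ⟨hne, h⟩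
        · exact Or.inr h
      · rintro (⟨hne, hy⟩ | hy)
        · exact (this.mpr (Or.inl hy)).resolve_left hne
        · exact (this.mpr (Or.inr hy)).resolve_left (by omega)
    · rcases hb with hb | hb
      · exact hb.2
      · omega
  · rintro ⟨hw, hmem, hpw, hav, hb⟩
    have hxw : x ∉ w := by
      rw [hmem]
      rintro (h | h)
      · exact h.1 rfl
      · omega
    refine ⟨⟨hxw, hw⟩, fun y => ?_, ⟨fun y hy hyM => ?_, hpw⟩, ⟨?_, hav⟩, Or.inl ⟨hxp, hb⟩⟩
    · rw [hmem]
      by_cases hyx : y = x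
      · simp [hyx, hx]
      · simp [hyx]
    · rcases (hmem y).mp hy with h | h
      · exact hmax y h.2
      · omega
    · exact hpw.imp fun h hbx => h (by omega)

/-- The new maximum `x` imposes a stronger condition than `M`, and the letters between them become
skipped. -/
theorem isCompletion_cons_unread {S : Finset ℕ} {M n h p x : ℕ} {w : List ℕ}
    (hS : ∀ y ∈ S, y < p) (hp : p ≤ M) (hx : M < x) (hxn : x ≤ n) (hh : 0 < h) :
    IsCompletion S M n h p (x :: w)
      ↔ IsCompletion (S ∪ Finset.Ioo M x) x n (h - 1) x w := by
  simp only [IsCompletion, Avoids312, IsBallot, List.nodup_cons, List.pairwise_cons,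
    List.mem_cons, Finset.mem_union, Finset.mem_Ioo]
  constructor
  · rintro ⟨⟨hxw, hw⟩, hmem, -, ⟨hpw, hav⟩, hb⟩
    refine ⟨hw, fun y => ?_, ?_, hav, ?_⟩
    · have := hmem y
      constructor
      · intro hy
        have hne : y ≠ x := by rintro rfl; exact hxw hy
        rcases this.mp (Or.inr hy) with h | h
        · exact Or.inl (Or.inl h)
        · omega
      · rintro ((hy | hy) | hy)
        · have := hS y hy
          exact ((hmem y).mpr (Or.inl hy)).resolve_left (by omega)
        · exact (this.mpr (Or.inr (by omega))).resolve_left (by omega)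
        · exact (this.mpr (Or.inr (by omega))).resolve_left (by omega)
    · refine hpw.imp_of_mem fun {a b} _ hbw h hbx => h ?_
      have hne : b ≠ x := by rintro rfl; exact hxw hbw
      omega
    · rcases hb with hb | hb
      · omega
      · exact hb.2.2
  · rintro ⟨hw, hmem, hpw, hav, hb⟩
    have hxw : x ∉ w := by
      rw [hmem]
      rintro ((h | h) | h)
      · have := hS x h
        omega
      · omega
      · omega
    refine ⟨⟨hxw, hw⟩, fun y => ?_, ⟨fun y hy hyM => by omega, ?_⟩, ⟨?_, hav⟩,
      Or.inr ⟨by omega, hh, hb⟩⟩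
    · rw [hmem]
      by_cases hyx : y = x
      · simp [hyx, hx, hxn]
      · by_cases hyS : y ∈ S
        · simp [hyS]
        · simp only [hyx, hyS, false_or]
          omega
    · exact hpw.imp fun h hbM => h (by omega)
    · exact hpw.imp fun h hbx => h (by omega)

/-- The invariant is that all skipped letters lie below the last letter `p`, so reading one is
always a descent. -/
theorem exists_card_isCompletion (r : ℕ) (S : Finset ℕ) (M n h p : ℕ) (hS : ∀ y ∈ S, y < p)
    (hp : p ≤ M) (hM : M ≤ n) (hr : S.card + (n - M) = r) :
    ∃ F : Finset (List ℕ), (∀ w, w ∈ F ↔ IsCompletion S M n h p w) ∧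
      F.card = completions r S.card (n - M) h := by
  classical
  induction r generalizing S M h p with
  | zero =>
    have hS0 : S = ∅ := by rw [← Finset.card_eq_zero]; omega
    have hnil : ∀ w, IsCompletion S M n h p w ↔ w = [] ∧ h = 0 := by
      intro w
      constructor
      · rintro ⟨-, hmem, -, -, hb⟩
        have : w = [] := by
          refine List.eq_nil_iff_forall_not_mem.mpr fun y hy => ?_
          rcases (hmem y).mp hy with h | h
          · simp [hS0] at h
          · omega
        subst this
        exact ⟨rfl, hb⟩
      · rintro ⟨rfl, rfl⟩
        refine ⟨List.nodup_nil, fun y => ?_, List.Pairwise.nil, trivial, rfl⟩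
        simp only [hS0, List.not_mem_nil, Finset.notMem_empty, false_or, false_iff]
        omega
    by_cases hh : h = 0
    · exact ⟨{[]}, fun w => by rw [hnil]; simp [hh], by simp [completions, hh]⟩
    · exact ⟨∅, fun w => by rw [hnil]; simp [hh], by simp [completions, hh]⟩
  | succ r ih =>
    -- The possible first letters: the maximum of `S`, if any, and the letters above `M`, barred at
    -- height 0 because an ascent would go below it.
    set I₁ : Finset ℕ := S.filter fun x => ∀ y ∈ S, y ≤ x with hI₁
    set I₂ : Finset ℕ := if h = 0 then ∅ else Finset.Ioc M n with hI₂
    have hI₂mem : ∀ x, x ∈ I₂ ↔ 0 < h ∧ M < x ∧ x ≤ n := by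
      intro x
      rw [hI₂]
      split_ifs with hh
      · simp [hh]
      · simp only [Finset.mem_Ioc]
        omega
    have hdisj : Disjoint I₁ I₂ := by
      rw [Finset.disjoint_left]
      intro x hx hx'
      have := hS x (Finset.mem_filter.mp hx).1
      have := (hI₂mem x).mp hx'
      omega
    refine (exists_card_eq_sum_of_cons (IsCompletion S M n h p) (I₁ ∪ I₂)
      (fun x => if x ∈ S then IsCompletion (S.erase x) M n (h + 1) x
        else IsCompletion (S ∪ Finset.Ioo M x) x n (h - 1) x)
      (fun x => if x ∈ S then completions r (S.card - 1) (n - M) (h + 1)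
        else completions r (S.card + (x - (M + 1))) (n - M - 1 - (x - (M + 1))) (h - 1))
      ?_ ?_ ?_).imp fun F hF => ⟨hF.1, hF.2.trans ?_⟩
    rotate_right
    · rw [Finset.sum_union hdisj, completions]
      congr 1
      · rw [Finset.sum_congr rfl fun x hx => if_pos (Finset.mem_filter.mp hx).1,
          Finset.sum_const]
        by_cases h0 : S.card = 0
        · have hS0 : S = ∅ := Finset.card_eq_zero.mp h0
          simp [hS0]
        · have hne : S.Nonempty := Finset.card_ne_zero.mp h0
          have : I₁ = {S.max' hne} := by
            ext x
            simp only [hI₁, Finset.mem_filter, Finset.mem_singleton]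
            constructor
            · rintro ⟨hx, hx'⟩
              exact le_antisymm (S.le_max' x hx) (hx' _ (S.max'_mem hne))
            · rintro rfl
              exact ⟨S.max'_mem hne, fun y hy => S.le_max' y hy⟩
          have hc : (S.filter fun x => ∀ y ∈ S, y ≤ x).card = 1 := by
            rw [← hI₁, this, Finset.card_singleton]
          rw [if_neg h0, hc, one_smul]
      · by_cases hh : h = 0
        · simp [hI₂, hh]
        · rw [if_neg hh, hI₂, if_neg hh]
          have himg : Finset.Ioc M n = (Finset.range (n - M)).image fun i => M + 1 + i := by
            ext x
            simp only [Finset.mem_Ioc, Finset.mem_image, Finset.mem_range]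
            constructor
            · intro hx
              exact ⟨x - (M + 1), by omega, by omega⟩
            · rintro ⟨i, hi, rfl⟩
              omega
          rw [himg, Finset.sum_image fun _ _ _ _ h => Nat.add_left_cancel h]
          refine Finset.sum_congr rfl fun i hi => ?_
          have hiS : M + 1 + i ∉ S := fun hi' => by
            have := hS _ hi'
            omega
          rw [if_neg hiS, show M + 1 + i - (M + 1) = i by omega]
    · rintro ⟨-, hmem, -, -, -⟩
      by_cases h0 : S.card = 0
      · exact List.not_mem_nil ((hmem n).mpr (Or.inr (by omega)))
      · obtain ⟨y, hy⟩ := Finset.card_ne_zero.mp h0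
        exact List.not_mem_nil ((hmem y).mpr (Or.inl hy))
    · intro x w
      rw [Finset.mem_union, hI₂mem]
      by_cases hxS : x ∈ S
      · rw [if_pos hxS]
        have hxp := hS x hxS
        constructor
        · intro hc
          have hmax : ∀ y ∈ S, y ≤ x := by
            intro y hy
            have hyp := hS y hy
            rcases List.mem_cons.mp ((hc.2.1 y).mpr (Or.inl hy)) with h | h
            · omega
            · exact (List.pairwise_cons.mp hc.2.2.1).1 y h (by omega)
          exact ⟨Or.inl (Finset.mem_filter.mpr ⟨hxS, hmax⟩),
            (isCompletion_cons_skipped hS hp hxS hmax).mp hc⟩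
        · rintro ⟨hx | hx, hc⟩
          · exact (isCompletion_cons_skipped hS hp hxS (Finset.mem_filter.mp hx).2).mpr hc
          · omega
      · rw [if_neg hxS]
        constructor
        · intro hc
          have hx := ((hc.2.1 x).mp List.mem_cons_self).resolve_left hxS
          have hh : 0 < h := by
            rcases hc.2.2.2.2 with h | h
            · omega
            · exact h.2.1
          exact ⟨Or.inr ⟨hh, hx⟩, (isCompletion_cons_unread hS hp hx.1 hx.2 hh).mp hc⟩
        · rintro ⟨hx | ⟨hh, hx⟩, hc⟩
          · exact absurd (Finset.mem_filter.mp hx).1 hxS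
          · exact (isCompletion_cons_unread hS hp hx.1 hx.2 hh).mpr hc
    · intro x hx
      by_cases hxS : x ∈ S
      · simp only [if_pos hxS]
        have hxp := hS x hxS
        have hmax : ∀ y ∈ S, y ≤ x := by
          rcases Finset.mem_union.mp hx with hx | hx
          · exact (Finset.mem_filter.mp hx).2
          · have := (hI₂mem x).mp hx
            omega
        have hpos : 0 < S.card := Finset.card_pos.mpr ⟨x, hxS⟩
        have hcard := Finset.card_erase_of_mem hxS
        rw [← hcard]
        refine ih (S.erase x) M (h + 1) x (fun y hy => ?_) (by omega) hM (by omega)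
        have := hmax y (Finset.mem_of_mem_erase hy)
        have := Finset.ne_of_mem_erase hy
        omega
      · simp only [if_neg hxS]
        have hx' : 0 < h ∧ M < x ∧ x ≤ n := by
          rcases Finset.mem_union.mp hx with hx | hx
          · exact absurd (Finset.mem_filter.mp hx).1 hxS
          · exact (hI₂mem x).mp hx
        have hcard : (S ∪ Finset.Ioo M x).card = S.card + (x - (M + 1)) := by
          rw [Finset.card_union_of_disjoint, Nat.card_Ioo, Nat.sub_sub]
          rw [Finset.disjoint_left]
          intro y hy hy'
          have := hS y hy
          have := Finset.mem_Ioo.mp hy'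
          omega
        rw [← hcard, show n - M - 1 - (x - (M + 1)) = n - x by omega]
        refine ih _ x (h - 1) x (fun y hy => ?_) le_rfl hx'.2.2 (by omega)
        rcases Finset.mem_union.mp hy with hy | hy
        · have := hS y hy
          omega
        · exact (Finset.mem_Ioo.mp hy).2

theorem ncard_ballot_avoiding (n : ℕ) :
    {π | π ∈ symmetricWords n ∧ Avoids312 π ∧ IsBallot 1 0 π}.ncard = completions n 0 n 1 := by
  obtain ⟨F, hF, hcard⟩ := exists_card_isCompletion n ∅ 0 n 1 0 (by simp) le_rfl (Nat.zero_le n)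
    (by simp)
  have : {π | π ∈ symmetricWords n ∧ Avoids312 π ∧ IsBallot 1 0 π} = (F : Set (List ℕ)) := by
    ext π
    simp only [Set.mem_ofPred_eq, Finset.mem_coe, hF, IsCompletion, symmetricWords, IsPermutation,
      Finset.notMem_empty, false_or]
    constructor
    · rintro ⟨⟨⟨hnd, hpos⟩, hmem⟩, hav, hb⟩
      refine ⟨hnd, hmem, ?_, hav, hb⟩
      exact List.pairwise_of_forall_mem_list fun a _ b hb h => by
        have := hpos b hb
        omega
    · rintro ⟨hnd, hmem, -, hav, hb⟩
      exact ⟨⟨⟨hnd, fun a ha => ((hmem a).mp ha).1⟩, hmem⟩, hav, hb⟩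
  rw [this, Set.ncard_coe_finset, hcard]
  simp

/-! ### Factorization of stack-sorted words. -/

theorem IsPermutation.sublist {σ π : List ℕ} (h : IsPermutation π) (hs : σ.Sublist π) :
    IsPermutation σ :=
  ⟨h.1.sublist hs, fun a ha => h.2 a (hs.subset ha)⟩

theorem IsPermutation.perm {σ π : List ℕ} (h : IsPermutation π) (hp : σ.Perm π) :
    IsPermutation σ :=
  ⟨hp.nodup_iff.mpr h.1, fun a ha => h.2 a (hp.subset ha)⟩

theorem le_largestEntry {a : ℕ} {l : List ℕ} (h : a ∈ l) : a ≤ largestEntry l := by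
  induction l with
  | nil => simp at h
  | cons b l ih =>
    have e : largestEntry (b :: l) = max b (largestEntry l) := rfl
    rw [e]
    rcases List.mem_cons.mp h with rfl | h
    · exact le_max_left _ _
    · exact (ih h).trans (le_max_right _ _)

theorem stackSort_eq {π : List ℕ} (h : π ≠ []) :
    stackSort π = stackSort (wordBefore (largestEntry π) π)
      ++ stackSort (wordAfter (largestEntry π) π) ++ [largestEntry π] := by
  cases π with
  | nil => exact absurd rfl h
  | cons a l => rw [stackSort]

theorem stackSort_node {L R : List ℕ} {m : ℕ} (hL : ∀ a ∈ L, a < m) (hR : ∀ a ∈ R, a < m) :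
    stackSort (L ++ m :: R) = stackSort L ++ stackSort R ++ [m] := by
  have hm : largestEntry (L ++ m :: R) = m := by
    apply le_antisymm
    · have hmem : largestEntry (L ++ m :: R) ∈ L ++ m :: R := by
        cases L <;> exact largestEntry_mem _ _
      rcases List.mem_append.mp hmem with h | h
      · exact (hL _ h).le
      · rcases List.mem_cons.mp h with h | h
        · exact h.le
        · exact (hR _ h).le
    · exact le_largestEntry (by simp)
  have hbefore : wordBefore m (L ++ m :: R) = L ∧ wordAfter m (L ++ m :: R) = R := by
    clear hm
    induction L with
    | nil => simp [wordBefore, wordAfter]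
    | cons a L ih =>
      have ha := (hL a List.mem_cons_self).ne
      have := ih fun b hb => hL b (List.mem_cons_of_mem _ hb)
      simp only [wordBefore, wordAfter] at this ⊢
      simpa [List.takeWhile_cons, List.dropWhile_cons, ha] using this
  rw [stackSort_eq (by simp), hm, hbefore.1, hbefore.2]

theorem exists_eq_node {σ : List ℕ} (hσ : σ.Nodup) (hne : σ ≠ []) :
    ∃ L m R, σ = L ++ m :: R ∧ (∀ a ∈ L, a < m) ∧ ∀ a ∈ R, a < m := by
  have hmem : largestEntry σ ∈ σ := by
    cases σ with
    | nil => exact absurd rfl hne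
    | cons a l => exact largestEntry_mem a l
  obtain ⟨L, R, h⟩ := List.append_of_mem hmem
  have hnd := hσ
  rw [h, List.nodup_middle, List.nodup_cons, List.mem_append, not_or] at hnd
  refine ⟨L, _, R, h, fun a ha => ?_, fun a ha => ?_⟩
  · refine lt_of_le_of_ne (le_largestEntry (by rw [h]; simp [ha])) ?_
    rintro rfl
    exact hnd.1.1 ha
  · refine lt_of_le_of_ne (le_largestEntry (by rw [h]; simp [ha])) ?_
    rintro rfl
    exact hnd.1.2 ha

theorem node_perm (L R : List ℕ) (m : ℕ) : (L ++ m :: R).Perm (L ++ R ++ [m]) :=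
  List.perm_middle.trans (List.perm_append_singleton m (L ++ R)).symm

theorem stackSort_perm {σ : List ℕ} (hσ : σ.Nodup) : (stackSort σ).Perm σ := by
  induction hn : σ.length using Nat.strong_induction_on generalizing σ with
  | _ n ih =>
    by_cases hne : σ = []
    · subst hne
      simp [stackSort]
    · obtain ⟨L, m, R, rfl, hL, hR⟩ := exists_eq_node hσ hne
      rw [List.length_append, List.length_cons] at hn
      rw [stackSort_node hL hR]
      have hs := List.nodup_append.mp hσ
      have h1 := ih _ (by omega) hs.1 rfl
      have h2 := ih _ (by omega) (List.nodup_cons.mp hs.2.1).2 rfl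
      exact ((h1.append h2).append_right [m]).trans (node_perm L R m).symm

/-- `π` has at least one preimage under the stack-sorting map. -/
def IsStackSorted (π : List ℕ) : Prop :=
  ∃ σ, IsPermutation σ ∧ stackSort σ = π

theorem IsStackSorted.isPermutation {π : List ℕ} (h : IsStackSorted π) : IsPermutation π := by
  obtain ⟨σ, hσ, rfl⟩ := h
  exact hσ.perm (stackSort_perm hσ.1)

theorem isStackSorted_nil : IsStackSorted [] :=
  ⟨[], ⟨List.nodup_nil, by simp⟩, by rw [stackSort]⟩

theorem isPermutation_node {L R : List ℕ} {m : ℕ} (hL : IsPermutation L) (hR : IsPermutation R)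
    (hπ : IsPermutation (stackSort L ++ stackSort R ++ [m])) : IsPermutation (L ++ m :: R) := by
  refine hπ.perm ((node_perm L R m).trans (List.Perm.append_right [m] ?_))
  exact (stackSort_perm hL.1).symm.append (stackSort_perm hR.1).symm

theorem stackSort_node_of_image {L R : List ℕ} {m : ℕ} (hL : IsPermutation L)
    (hR : IsPermutation R) (hA : ∀ a ∈ stackSort L, a < m) (hB : ∀ a ∈ stackSort R, a < m) :
    stackSort (L ++ m :: R) = stackSort L ++ stackSort R ++ [m] :=
  stackSort_node (fun a ha => hA a ((stackSort_perm hL.1).mem_iff.mpr ha))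
    (fun a ha => hB a ((stackSort_perm hR.1).mem_iff.mpr ha))

theorem IsStackSorted.node {A B : List ℕ} {m : ℕ} (hA : IsStackSorted A) (hB : IsStackSorted B)
    (hAm : ∀ a ∈ A, a < m) (hBm : ∀ a ∈ B, a < m) (hπ : IsPermutation (A ++ B ++ [m])) :
    IsStackSorted (A ++ B ++ [m]) := by
  obtain ⟨L, hL, rfl⟩ := hA
  obtain ⟨R, hR, rfl⟩ := hB
  exact ⟨L ++ m :: R, isPermutation_node hL hR hπ, stackSort_node_of_image hL hR hAm hBm⟩

theorem exists_node_of_stackSort_eq {σ π : List ℕ} (hσ : IsPermutation σ) (h : stackSort σ = π)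
    (hne : π ≠ []) :
    ∃ L m R, σ = L ++ m :: R ∧ IsPermutation L ∧ IsPermutation R ∧
      (∀ a ∈ stackSort L, a < m) ∧ (∀ a ∈ stackSort R, a < m) ∧
      π = stackSort L ++ stackSort R ++ [m] := by
  have hσne : σ ≠ [] := by
    rintro rfl
    exact hne (by rw [← h, stackSort])
  obtain ⟨L, m, R, rfl, hL, hR⟩ := exists_eq_node hσ.1 hσne
  have hLp : IsPermutation L := hσ.sublist (List.sublist_append_left _ _)
  have hRp : IsPermutation R :=
    hσ.sublist ((List.sublist_cons_self _ _).trans (List.sublist_append_right _ _))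
  refine ⟨L, m, R, rfl, hLp, hRp, fun a ha => hL a ((stackSort_perm hLp.1).subset ha),
    fun a ha => hR a ((stackSort_perm hRp.1).subset ha), ?_⟩
  rw [← h, stackSort_node hL hR]

/-- Induction on the decomposition `A B m` of the image, with no mention of preimages. -/
theorem IsStackSorted.induction {P : List ℕ → Prop} (nil : P [])
    (node : ∀ A B m, IsStackSorted A → IsStackSorted B → (∀ a ∈ A, a < m) → (∀ a ∈ B, a < m) →
      IsPermutation (A ++ B ++ [m]) → P A → P B → P (A ++ B ++ [m]))
    {π : List ℕ} (h : IsStackSorted π) : P π := by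
  induction hn : π.length using Nat.strong_induction_on generalizing π with
  | _ n ih =>
    by_cases hne : π = []
    · rw [hne]
      exact nil
    · have hp := h.isPermutation
      obtain ⟨σ, hσ, hs⟩ := h
      obtain ⟨L, m, R, rfl, hL, hR, hLm, hRm, rfl⟩ := exists_node_of_stackSort_eq hσ hs hne
      simp only [List.length_append, List.length_cons, List.length_nil] at hn
      exact node _ _ m ⟨L, hL, rfl⟩ ⟨R, hR, rfl⟩ hLm hRm hp
        (ih _ (by omega) ⟨L, hL, rfl⟩ rfl) (ih _ (by omega) ⟨R, hR, rfl⟩ rfl)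

theorem IsStackSorted.exists_concat {A : List ℕ} (h : IsStackSorted A) (hne : A ≠ []) :
    ∃ A' a, A = A' ++ [a] ∧ ∀ x ∈ A, x ≤ a := by
  obtain ⟨σ, hσ, hs⟩ := h
  obtain ⟨L, m, R, -, -, -, hLm, hRm, rfl⟩ := exists_node_of_stackSort_eq hσ hs hne
  refine ⟨_, m, rfl, fun x hx => ?_⟩
  simp only [List.mem_append, List.mem_singleton] at hx
  rcases hx with (hx | hx) | hx
  · exact (hLm x hx).le
  · exact (hRm x hx).le
  · exact hx.le

/-! ### Height of stack-sorted words and the extremal case. -/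

/-- The number of descents minus the number of ascents when `w` is read after the letter `p`. -/
def descentHeight : ℕ → List ℕ → ℤ
  | _, [] => 0
  | p, x :: w => (if x < p then 1 else -1) + descentHeight x w

theorem descentHeight_append (p a : ℕ) (A B : List ℕ) :
    descentHeight p (A ++ [a] ++ B) = descentHeight p (A ++ [a]) + descentHeight a B := by
  induction A generalizing p with
  | nil => simp [descentHeight]
  | cons x A ih =>
    have := ih x
    simp only [List.cons_append, descentHeight] at this ⊢
    rw [this]
    ring

theorem descentHeight_concat {p m : ℕ} {A : List ℕ} (hA : ∀ a ∈ A, a < m) (hp : p ≤ m) :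
    descentHeight p (A ++ [m]) = descentHeight p A - 1 := by
  induction A generalizing p with
  | nil => simp [descentHeight, hp]
  | cons x A ih =>
    have := ih (fun a ha => hA a (List.mem_cons_of_mem _ ha)) (hA x List.mem_cons_self).le
    simp only [List.cons_append, descentHeight, this]
    ring

/-- Only the first step depends on the preceding letter; a descent there turns -1 into 1. -/
theorem descentHeight_cons (p b : ℕ) (B : List ℕ) :
    descentHeight p (b :: B) = descentHeight 0 (b :: B) + if b < p then 2 else 0 := by
  simp only [descentHeight, Nat.not_lt_zero, if_false]
  split_ifs <;> ring

/-- Each nonempty factor contributes at most -1, the junction at most 2 extra, and the final maximum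
-1. -/
theorem IsStackSorted.descentHeight_le {π : List ℕ} (h : IsStackSorted π) (hne : π ≠ []) :
    descentHeight 0 π ≤ -1 := by
  refine IsStackSorted.induction (P := fun π => π ≠ [] → descentHeight 0 π ≤ -1)
    (fun h => absurd rfl h) ?_ h hne
  intro A B m hA hB hAm hBm _ ihA ihB _
  rw [descentHeight_concat (by simpa [or_imp, forall_and] using ⟨hAm, hBm⟩) (Nat.zero_le m)]
  by_cases hA0 : A = []
  · subst hA0
    by_cases hB0 : B = []
    · simp [hB0, descentHeight]
    · have := ihB hB0
      rw [List.nil_append]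
      omega
  · have h1 := ihA hA0
    by_cases hB0 : B = []
    · simp only [hB0, List.append_nil]
      omega
    · have h2 := ihB hB0
      obtain ⟨A', a, rfl, -⟩ := hA.exists_concat hA0
      obtain ⟨b, B', rfl⟩ := List.exists_cons_of_ne_nil hB0
      rw [descentHeight_append, descentHeight_cons a]
      split_ifs <;> omega

theorem node_cases_of_descentHeight_eq {A B : List ℕ} {m : ℕ} (hA : IsStackSorted A)
    (hB : IsStackSorted B) (hAm : ∀ a ∈ A, a < m) (hBm : ∀ a ∈ B, a < m)
    (h : descentHeight 0 (A ++ B ++ [m]) = -1) :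
    (A = [] ∧ B = []) ∨ ∃ A' a b B', A = A' ++ [a] ∧ B = b :: B' ∧ b < a ∧
      descentHeight 0 A = -1 ∧ descentHeight 0 B = -1 := by
  rw [descentHeight_concat (by simpa [or_imp, forall_and] using ⟨hAm, hBm⟩) (Nat.zero_le m)] at h
  by_cases hA0 : A = []
  · subst hA0
    by_cases hB0 : B = []
    · exact Or.inl ⟨rfl, hB0⟩
    · have := hB.descentHeight_le hB0
      rw [List.nil_append] at h
      omega
  · have h1 := hA.descentHeight_le hA0
    by_cases hB0 : B = []
    · simp only [hB0, List.append_nil] at h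
      omega
    · have h2 := hB.descentHeight_le hB0
      obtain ⟨A', a, rfl, -⟩ := hA.exists_concat hA0
      obtain ⟨b, B', rfl⟩ := List.exists_cons_of_ne_nil hB0
      rw [descentHeight_append, descentHeight_cons a] at h
      split_ifs at h with hba
      · exact Or.inr ⟨A', a, b, B', rfl, rfl, hba, by omega, by omega⟩
      · omega

theorem IsBallot.descentHeight_eq {h p : ℕ} {w : List ℕ} (hw : IsBallot h p w) :
    (h : ℤ) + descentHeight p w = 0 := by
  induction w generalizing h p with
  | nil => simpa [IsBallot, descentHeight] using hw
  | cons x w ih =>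
    rw [descentHeight]
    rcases hw with ⟨hx, hw⟩ | ⟨hx, hh, hw⟩
    · have := ih hw
      rw [if_pos hx]
      push_cast at this
      omega
    · have := ih hw
      rw [if_neg (by omega)]
      omega

theorem IsBallot.descentHeight_prefix {h p : ℕ} {w w' : List ℕ} (hw : IsBallot h p (w ++ w')) :
    0 ≤ (h : ℤ) + descentHeight p w := by
  induction w generalizing h p with
  | nil => simp [descentHeight]
  | cons x w ih =>
    rw [descentHeight]
    rcases hw with ⟨hx, hw⟩ | ⟨hx, hh, hw⟩
    · have := ih hw
      rw [if_pos hx]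
      push_cast at this
      omega
    · have := ih hw
      rw [if_neg (by omega)]
      omega

/-- The suffix `w` is carried along so that `B m w` can serve as the suffix of `A` in the induction.
-/
theorem IsStackSorted.isBallot_append {π : List ℕ} (hπ : IsStackSorted π)
    (hd : descentHeight 0 π = -1) {h : ℕ} {w : List ℕ}
    (hw : ∀ a ∈ π.getLast?, IsBallot h a w) : IsBallot (h + 1) 0 (π ++ w) := by
  refine IsStackSorted.induction (P := fun π => descentHeight 0 π = -1 → ∀ h w,
    (∀ a ∈ π.getLast?, IsBallot h a w) → IsBallot (h + 1) 0 (π ++ w)) ?_ ?_ hπ hd h w hw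
  · intro h
    simp [descentHeight] at h
  · intro A B m hA hB hAm hBm _ ihA ihB hd h w hw
    have hw' : IsBallot h m w := hw m (by simp)
    rcases node_cases_of_descentHeight_eq hA hB hAm hBm hd with
      ⟨rfl, rfl⟩ | ⟨A', a, b, B', rfl, rfl, hba, hdA, hdB⟩
    · exact Or.inr ⟨Nat.zero_le _, Nat.succ_pos _, hw'⟩
    · rw [List.append_assoc, List.append_assoc]
      refine ihA hdA h _ fun x hx => ?_
      obtain rfl : a = x := by simpa using hx
      refine Or.inl ⟨hba, ?_⟩
      -- Read after 0, the letter `b` falls from `h + 2`; read after `a`, it rises from `h`. Both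
      -- reach `h + 1`, so the remaining path is the same.
      have key := ihB hdB (h + 1) ([m] ++ w) fun y hy => ?_
      · rcases key with hk | hk
        · exact absurd hk.1 (Nat.not_lt_zero _)
        · exact hk.2.2
      · exact Or.inr ⟨(hBm y (List.mem_of_getLast? hy)).le, Nat.succ_pos _, hw'⟩

theorem IsStackSorted.isBallot {π : List ℕ} (hπ : IsStackSorted π)
    (hd : descentHeight 0 π = -1) : IsBallot 1 0 π := by
  have := hπ.isBallot_append hd (h := 0) (w := []) fun _ _ => rfl
  rwa [List.append_nil] at this

/-- The letters of a stack-sorted word of extremal height split before the last letter in only one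
way into two such words. -/
theorem split_unique {A A' B B' : List ℕ} {a b : ℕ} {B₀ : List ℕ} (hB : IsStackSorted B)
    (hA : ∃ A₀, A = A₀ ++ [a]) (hb : B = b :: B₀) (hba : b < a)
    (hdA : descentHeight 0 A = -1) (hdA' : descentHeight 0 A' = -1)
    (hdB : descentHeight 0 B = -1) {C : List ℕ} (hC : A' = A ++ C) (hC' : B = C ++ B') :
    C = [] := by
  by_contra hne
  obtain ⟨c, C', rfl⟩ := List.exists_cons_of_ne_nil hne
  obtain ⟨A₀, rfl⟩ := hA
  obtain rfl : b = c := by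
    rw [hb, List.cons_append] at hC'
    exact (List.cons.inj hC').1
  -- Read after `a`, `C` has total 0, hence -2 when read after 0. As a prefix of `B` it would take
  -- the ballot path from 1 to -1.
  rw [hC, descentHeight_append, hdA, descentHeight_cons, if_pos hba] at hdA'
  have hbal := hB.isBallot hdB
  rw [hC'] at hbal
  have := hbal.descentHeight_prefix
  push_cast at this
  omega

theorem stackSort_injective_of_descentHeight {σ σ' : List ℕ} (hσ : IsPermutation σ)
    (hσ' : IsPermutation σ') (h : stackSort σ = stackSort σ')
    (hd : descentHeight 0 (stackSort σ) = -1) : σ = σ' := by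
  induction hn : σ.length using Nat.strong_induction_on generalizing σ σ' with
  | _ n ih =>
    have hne : stackSort σ ≠ [] := by
      intro h0
      rw [h0] at hd
      simp [descentHeight] at hd
    obtain ⟨L, m, R, rfl, hL, hR, hLm, hRm, hs⟩ := exists_node_of_stackSort_eq hσ rfl hne
    obtain ⟨L', m', R', rfl, hL', hR', hLm', hRm', hs'⟩ :=
      exists_node_of_stackSort_eq hσ' h.symm hne
    have hd' := hd
    rw [hs] at hd
    rw [hs'] at hd'
    rw [hs] at hs'
    obtain ⟨hsplit, hm⟩ := List.append_inj' hs' rfl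
    obtain rfl : m = m' := by simpa using hm
    have hc := node_cases_of_descentHeight_eq ⟨L, hL, rfl⟩ ⟨R, hR, rfl⟩ hLm hRm hd
    have hc' := node_cases_of_descentHeight_eq ⟨L', hL', rfl⟩ ⟨R', hR', rfl⟩ hLm' hRm' hd'
    have hnil : ∀ {ρ : List ℕ}, IsPermutation ρ → stackSort ρ = [] → ρ = [] := by
      intro ρ hρ h0
      have := stackSort_perm hρ.1
      rw [h0] at this
      exact this.nil_eq.symm
    rcases hc with ⟨hA, hB⟩ | ⟨A₀, a, b, B₀, hA, hB, hba, hdA, hdB⟩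
    · rw [hA, hB, List.append_nil] at hsplit
      obtain ⟨hA', hB'⟩ := List.append_eq_nil_iff.mp hsplit.symm
      rw [hnil hL hA, hnil hR hB, hnil hL' hA', hnil hR' hB']
    · rcases hc' with ⟨hA', hB'⟩ | ⟨A₀', a', b', B₀', hA', hB', hba', hdA', hdB'⟩
      · rw [hA', hB', hA] at hsplit
        simp at hsplit
      · have heq : stackSort L = stackSort L' ∧ stackSort R = stackSort R' := by
          rcases List.append_eq_append_iff.mp hsplit with ⟨C, h1, h2⟩ | ⟨C, h1, h2⟩
          · have := split_unique ⟨R, hR, rfl⟩ ⟨A₀, hA⟩ hB hba hdA hdA' hdB h1 h2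
            rw [this] at h1 h2
            exact ⟨by rw [h1, List.append_nil], h2⟩
          · have := split_unique ⟨R', hR', rfl⟩ ⟨A₀', hA'⟩ hB' hba' hdA' hdA hdB' h1 h2
            rw [this] at h1 h2
            exact ⟨by rw [h1, List.append_nil], h2.symm⟩
        rw [List.length_append, List.length_cons] at hn
        rw [ih _ (by omega) hL hL' heq.1 hdA rfl, ih _ (by omega) hR hR' heq.2 hdB rfl]

/-! ### Unique sortedness forces the extremal height. -/

theorem isUniquelySorted_iff (π : List ℕ) :
    IsUniquelySorted π ↔ IsStackSorted π ∧ ∀ σ σ', IsPermutation σ → IsPermutation σ' →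
      stackSort σ = π → stackSort σ' = π → σ = σ' := by
  rw [IsUniquelySorted, fertility, Set.ncard_eq_one]
  constructor
  · rintro ⟨τ, hτ⟩
    have hmem : ∀ σ, (IsPermutation σ ∧ stackSort σ = π) ↔ σ = τ := fun σ =>
      Set.ext_iff.mp hτ σ
    refine ⟨⟨τ, (hmem τ).mpr rfl⟩, fun σ σ' h1 h2 h3 h4 => ?_⟩
    rw [(hmem σ).mp ⟨h1, h3⟩, (hmem σ').mp ⟨h2, h4⟩]
  · rintro ⟨⟨τ, hτ, hs⟩, huniq⟩
    refine ⟨τ, Set.ext fun σ => ?_⟩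
    constructor
    · rintro ⟨h1, h2⟩
      exact huniq σ τ h1 hτ h2 hs
    · rintro rfl
      exact ⟨hτ, hs⟩

/-- `A` is grafted in front of the first letter of `B`: following leftmost nonempty factors leads to
a single letter, which exceeds all of `A` and takes it as left factor. -/
theorem IsStackSorted.append {A B : List ℕ} (hA : IsStackSorted A) (hB : IsStackSorted B)
    (hne : B ≠ []) (hp : IsPermutation (A ++ B)) (hlt : ∀ b ∈ B.head?, ∀ x ∈ A, x < b) :
    IsStackSorted (A ++ B) := by
  refine IsStackSorted.induction (P := fun B => B ≠ [] → IsPermutation (A ++ B) →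
    (∀ b ∈ B.head?, ∀ x ∈ A, x < b) → IsStackSorted (A ++ B)) (fun h => absurd rfl h) ?_
    hB hne hp hlt
  intro X Y m hX hY hXm hYm _ ihX ihY _ hp hlt
  by_cases hX0 : X = []
  · subst hX0
    by_cases hY0 : Y = []
    · subst hY0
      have hAm : ∀ a ∈ A, a < m := hlt m rfl
      have := hA.node isStackSorted_nil hAm (by simp) (by simpa using hp)
      simpa using this
    · obtain ⟨b, Y', rfl⟩ := List.exists_cons_of_ne_nil hY0
      have hAb : ∀ a ∈ A, a < b := hlt b rfl
      have hbm := hYm b List.mem_cons_self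
      have h1 : IsStackSorted (A ++ b :: Y') := by
        refine ihY hY0 (hp.sublist ?_) fun y hy => ?_
        · simp
        · obtain rfl : b = y := by simpa using hy
          exact hAb
      have h2 : ∀ x ∈ A ++ b :: Y', x < m := by
        intro x hx
        rcases List.mem_append.mp hx with hx | hx
        · exact (hAb x hx).trans hbm
        · exact hYm x hx
      have := h1.node isStackSorted_nil h2 (by simp) (by simpa using hp)
      simpa using this
  · obtain ⟨b, X', rfl⟩ := List.exists_cons_of_ne_nil hX0
    have hAb : ∀ a ∈ A, a < b := hlt b rfl
    have hbm := hXm b List.mem_cons_self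
    have h1 : IsStackSorted (A ++ b :: X') := by
      refine ihX hX0 (hp.sublist ?_) fun y hy => ?_
      · simp
      · obtain rfl : b = y := by simpa using hy
        exact hAb
    have h2 : ∀ x ∈ A ++ b :: X', x < m := by
      intro x hx
      rcases List.mem_append.mp hx with hx | hx
      · exact (hAb x hx).trans hbm
      · exact hXm x hx
    have := h1.node hY h2 hYm (by simpa using hp)
    simpa using this

/-- Both factors inherit uniqueness. Without a descent at their junction, `IsStackSorted.append`
would make their concatenation stack-sorted and so give a second preimage. -/
theorem IsUniquelySorted.descentHeight_eq {π : List ℕ} (h : IsUniquelySorted π) (hne : π ≠ []) :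
    descentHeight 0 π = -1 := by
  induction hn : π.length using Nat.strong_induction_on generalizing π with
  | _ n ih =>
    rw [isUniquelySorted_iff] at h
    obtain ⟨hsorted, huniq⟩ := h
    have hp := hsorted.isPermutation
    obtain ⟨σ, hσ, hs⟩ := hsorted
    obtain ⟨L, m, R, rfl, hL, hR, hLm, hRm, rfl⟩ := exists_node_of_stackSort_eq hσ hs hne
    simp only [List.length_append, List.length_cons, List.length_nil] at hn
    have hall : ∀ a ∈ stackSort L ++ stackSort R, a < m := by
      simpa [or_imp, forall_and] using ⟨hLm, hRm⟩
    by_cases hnil : stackSort L ++ stackSort R = []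
    · rw [hnil]
      simp [descentHeight]
    · have hns : ¬ IsStackSorted (stackSort L ++ stackSort R) := by
        rintro ⟨τ, hτ, hτs⟩
        have hτm : ∀ a ∈ τ, a < m := fun a ha =>
          hall a (by rw [← hτs]; exact (stackSort_perm hτ.1).mem_iff.mpr ha)
        have hempty : stackSort [] = [] := by rw [stackSort]
        have hpnil : IsPermutation [] := ⟨List.nodup_nil, by simp⟩
        have h1 : stackSort (τ ++ m :: []) = stackSort τ ++ stackSort [] ++ [m] :=
          stackSort_node hτm (by simp)
        have h2 : stackSort ([] ++ m :: τ) = stackSort [] ++ stackSort τ ++ [m] :=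
          stackSort_node (by simp) hτm
        have p1 : IsPermutation (τ ++ m :: []) :=
          isPermutation_node hτ hpnil (by rwa [hempty, List.append_nil, hτs])
        have p2 : IsPermutation ([] ++ m :: τ) :=
          isPermutation_node hpnil hτ (by rwa [hempty, List.nil_append, hτs])
        have heq := huniq _ _ p1 p2 (by rw [h1, hempty, List.append_nil, hτs])
          (by rw [h2, hempty, List.nil_append, hτs])
        cases τ with
        | nil =>
          rw [hempty] at hτs
          exact hnil hτs.symm
        | cons t τ =>
          have := hτm t List.mem_cons_self
          simp only [List.cons_append, List.nil_append, List.cons.injEq] at heq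
          omega
      have hA : stackSort L ≠ [] := by
        intro h0
        rw [h0, List.nil_append] at hns
        exact hns ⟨R, hR, rfl⟩
      have hB : stackSort R ≠ [] := by
        intro h0
        rw [h0, List.append_nil] at hns
        exact hns ⟨L, hL, rfl⟩
      have huL : IsUniquelySorted (stackSort L) := by
        refine (isUniquelySorted_iff _).mpr ⟨⟨L, hL, rfl⟩, fun ρ ρ' h1 h2 h3 h4 => ?_⟩
        have := huniq (ρ ++ m :: R) (ρ' ++ m :: R)
          (isPermutation_node h1 hR (by rwa [h3])) (isPermutation_node h2 hR (by rwa [h4]))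
          (by rw [stackSort_node_of_image h1 hR (by rwa [h3]) hRm, h3])
          (by rw [stackSort_node_of_image h2 hR (by rwa [h4]) hRm, h4])
        exact List.append_cancel_right this
      have huR : IsUniquelySorted (stackSort R) := by
        refine (isUniquelySorted_iff _).mpr ⟨⟨R, hR, rfl⟩, fun ρ ρ' h1 h2 h3 h4 => ?_⟩
        have := huniq (L ++ m :: ρ) (L ++ m :: ρ')
          (isPermutation_node hL h1 (by rwa [h3])) (isPermutation_node hL h2 (by rwa [h4]))
          (by rw [stackSort_node_of_image hL h1 hLm (by rwa [h3]), h3])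
          (by rw [stackSort_node_of_image hL h2 hLm (by rwa [h4]), h4])
        exact (List.cons.inj (List.append_cancel_left this)).2
      have hdA := ih _ (by omega) huL hA rfl
      have hdB := ih _ (by omega) huR hB rfl
      rw [descentHeight_concat hall (Nat.zero_le m)]
      obtain ⟨A', a, hA', hmax⟩ := IsStackSorted.exists_concat ⟨L, hL, rfl⟩ hA
      obtain ⟨b, B', hB'⟩ := List.exists_cons_of_ne_nil hB
      have hpAB : IsPermutation (stackSort L ++ stackSort R) :=
        hp.sublist (List.sublist_append_left _ _)
      have hba : b < a := by
        by_contra hab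
        refine hns (IsStackSorted.append ⟨L, hL, rfl⟩ ⟨R, hR, rfl⟩ hB hpAB ?_)
        intro y hy x hx
        obtain rfl : b = y := by simpa [hB'] using hy
        have hne : x ≠ b := (List.nodup_append.mp hpAB.1).2.2 x hx b (by simp [hB'])
        have := hmax x hx
        omega
      rw [hA'] at hdA ⊢
      rw [hB'] at hdB ⊢
      rw [descentHeight_append, descentHeight_cons, if_pos hba, hdA, hdB]
      norm_num

/-! ### Ballot words avoiding 312 are uniquely sorted. -/

/-- The word is parsed with a stack of stack-sorted blocks whose size is the height. A descent
pushes the current block and opens a new one; an ascent to `y` merges the top block, the current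
block and `y`. -/
theorem isStackSorted_of_isBallot_of_blocks {w : List ℕ} {blocks : List (List ℕ)} {h x : ℕ}
    {A : List ℕ} (hlen : blocks.length = h) (hA : IsStackSorted (A ++ [x]))
    (hblocks : ∀ B ∈ blocks, IsStackSorted B)
    (hp : IsPermutation (blocks.reverse.flatten ++ (A ++ [x]) ++ w))
    (hav : ¬ ContainsPattern (blocks.reverse.flatten ++ (A ++ [x]) ++ w) [3, 1, 2])
    (hbal : IsBallot h x w) : IsStackSorted (blocks.reverse.flatten ++ (A ++ [x]) ++ w) := by
  induction w generalizing blocks h x A with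
  | nil =>
    obtain rfl : blocks = [] := List.eq_nil_of_length_eq_zero (hlen.trans hbal)
    simpa using hA
  | cons y w ih =>
    rcases hbal with ⟨-, hbal⟩ | ⟨hxy, hh, hbal⟩
    · have heq : blocks.reverse.flatten ++ (A ++ [x]) ++ y :: w
          = ((A ++ [x]) :: blocks).reverse.flatten ++ ([] ++ [y]) ++ w := by simp
      rw [heq] at hp hav ⊢
      refine ih (by simp [hlen]) ?_ ?_ hp hav hbal
      · refine isStackSorted_nil.node isStackSorted_nil (by simp) (by simp) (hp.sublist ?_)
        exact (List.sublist_append_right _ _).trans (List.sublist_append_left _ _)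
      · intro B hB
        rcases List.mem_cons.mp hB with rfl | hB
        · exact hA
        · exact hblocks B hB
    · cases blocks with
      | nil =>
        rw [List.length_nil] at hlen
        omega
      | cons B blocks =>
        have heq : (B :: blocks).reverse.flatten ++ (A ++ [x]) ++ y :: w
            = blocks.reverse.flatten ++ ((B ++ (A ++ [x])) ++ [y]) ++ w := by simp
        rw [heq] at hp hav ⊢
        have hsub : (B ++ (A ++ [x]) ++ [y]).Sublist
            (blocks.reverse.flatten ++ ((B ++ (A ++ [x])) ++ [y]) ++ w) :=
          (List.sublist_append_right _ _).trans (List.sublist_append_left _ _)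
        have hp' := hp.sublist hsub
        have hne : ∀ c ∈ B ++ (A ++ [x]), c ≠ y := fun c hc =>
          (List.nodup_append.mp hp'.1).2.2 c hc y (by simp)
        have hxy' : x < y := lt_of_le_of_ne hxy (hne x (by simp))
        -- Merging needs `y` to be maximal: a larger `c` would form a 312 with `x` and `y`.
        have hlt : ∀ c ∈ B ++ (A ++ [x]), c < y := by
          intro c hc
          by_contra hcy
          have hc' : c ∈ B ++ A := by
            rw [← List.append_assoc, List.mem_append, List.mem_singleton] at hc
            exact hc.resolve_right (by omega)
          refine hav ((containsPattern_312_iff _).mpr ⟨c, x, y, ?_, hxy', ?_⟩)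
          · refine List.Sublist.trans ?_ hsub
            have := (List.singleton_sublist.mpr hc').append (List.Sublist.refl [x, y])
            simpa using this
          · exact lt_of_le_of_ne (not_lt.mp hcy) (hne c hc).symm
        refine ih (by rw [List.length_cons] at hlen; omega) ?_ ?_ hp hav hbal
        · exact (hblocks B List.mem_cons_self).node hA
            (fun a ha => hlt a (List.mem_append_left _ ha))
            (fun a ha => hlt a (List.mem_append_right _ ha)) hp'
        · exact fun B' hB' => hblocks B' (List.mem_cons_of_mem _ hB')

theorem isStackSorted_of_isBallot {π : List ℕ} (hp : IsPermutation π)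
    (hav : AvoidsPattern π [3, 1, 2]) (hbal : IsBallot 1 0 π) : IsStackSorted π := by
  cases π with
  | nil => exact isStackSorted_nil
  | cons x w =>
    rcases hbal with hbal | ⟨-, -, hbal⟩
    · exact absurd hbal.1 (Nat.not_lt_zero x)
    · have hx : IsStackSorted ([] ++ [x]) :=
        isStackSorted_nil.node isStackSorted_nil (by simp) (by simp)
          (hp.sublist (by simp))
      exact isStackSorted_of_isBallot_of_blocks (blocks := []) rfl hx (by simp) hp hav hbal

theorem isUniquelySorted_iff_isBallot {π : List ℕ} (hp : IsPermutation π) (hne : π ≠ [])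
    (hav : AvoidsPattern π [3, 1, 2]) : IsUniquelySorted π ↔ IsBallot 1 0 π := by
  constructor
  · intro h
    exact ((isUniquelySorted_iff π).mp h).1.isBallot (h.descentHeight_eq hne)
  · intro h
    refine (isUniquelySorted_iff π).mpr
      ⟨isStackSorted_of_isBallot hp hav h, fun σ σ' h1 h2 h3 h4 => ?_⟩
    refine stackSort_injective_of_descentHeight h1 h2 (h3.trans h4.symm) ?_
    have := h.descentHeight_eq
    rw [h3]
    push_cast at this
    omega

/-- The case `n = 0` is excluded because the empty word is uniquely sorted, yet its path stays at 1.
-/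
theorem ncard_uniquelySortedAvoiding_312 (n : ℕ) (hn : 0 < n) :
    (uniquelySortedAvoiding n [3, 1, 2]).ncard = completions n 0 n 1 := by
  rw [← ncard_ballot_avoiding]
  congr 1
  ext π
  change (_ ∧ _ ∧ _) ↔ (_ ∧ _ ∧ _)
  refine and_congr_right fun hπ => ?_
  have hne : π ≠ [] := List.ne_nil_of_mem ((hπ.2 n).mpr ⟨hn, le_rfl⟩)
  rw [← avoidsPattern_312_iff, and_comm]
  exact and_congr_right fun hav => isUniquelySorted_iff_isBallot hπ.1 hne hav

theorem corollary1 (k : ℕ) :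
    ((uniquelySortedAvoiding (2 * k + 1) [3, 1, 2]).ncard : ℚ)
        = (catalan k : ℚ) * (catalan (k + 2) : ℚ) - (catalan (k + 1) : ℚ) ^ 2 ∧
      (catalan k : ℚ) * (catalan (k + 2) : ℚ) - (catalan (k + 1) : ℚ) ^ 2
        = 6 / (((k : ℚ) + 1) * ((k : ℚ) + 2) ^ 2 * ((k : ℚ) + 3))
          * ((2 * k).choose k : ℚ) * ((2 * k + 2).choose (k + 1) : ℚ) := by
  refine ⟨?_, catalan_mul_sub_sq k⟩
  rw [ncard_uniquelySortedAvoiding_312 _ (Nat.succ_pos _), ← pathPairs_self,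
    ← completions_two_mul_add_one]
  push_cast
  rfl
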